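/- A ranking of $m$ items is a permutation $\pi$ of the items, $\pi(i)$ being the position of item $i$. For rankings $\sigma,\pi$ let $K(\sigma,\pi)=|\{(i,j):\sigma(i)<\sigma(j),\ \pi(i)>\pi(j)\}|$ be the Kendall tau distance; for $\Pi=(\pi_1,\dots,\pi_n)$ let $\bar K(\sigma,\Pi)=\frac1n\sum_{k=1}^n K(\sigma,\pi_k)$ and $\mathrm{OPT}(\Pi)=\min_\sigma \bar K(\sigma,\Pi)$. In the (interactive) local model, user $k$ holds $\pi_k$ and a server, which sees no ranking, adaptively sends messages to users and receives their randomized answers, each of which depends only on the user's own ranking, the message, $m$, $n$, and fresh private randomness; finally it outputs a ranking. The transcript consists of all messages and answers (and the server's random draws). The algorithm is $\epsilon$-differentially private in the local model if, for all $\Pi,\Pi'$ that differ in the ranking of one user and every set $S$ of transcripts, $\Pr[\mathcal T(\Pi)\in S]\le e^{\epsilon}\Pr[\mathcal T(\Pi')\in S]$. It is an $(\alpha,\beta)$-approximation if its output $\sigma$ satisfies $\mathbb E[\bar K(\sigma,\Pi)]\le\alpha\cdot\mathrm{OPT}(\Pi)+\beta$ for every $\Pi$. Theorem. For every $\xi>0$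 there are a constant $C>0$ and a polynomial $p$, depending only on $\xi$, such that for every $\epsilon>0$ there is an interactive algorithm in the local model which, for all $m,n\ge1$ ($m$ items, $n$ users), runs in time at most $p(nm)$ (the server, and each answer of a user), is $\epsilon$-differentially private in the local model, and is a $(5+\xi,\beta)$-approximation algorithm for rank aggregation with $$\beta = C\cdot\frac{m^{2.5}\log m}{\min\{\epsilon,\max\{1,\log m\}\}\,\sqrt n}.$$ In particular, $\beta=O_\xi\!\left(\frac{m^{2.5}\log m}{\epsilon\sqrt n}\right)$ whenever $\epsilon\le\max\{1,\log m\}$. -/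

import Mathlib

noncomputable section

namespace RankAgg

/-! ### Rank aggregation

A ranking of the `m` items `Fin m` is a permutation `π`; `π i` is the position of item `i`. -/

/-- Rankings of `m` items. -/
abbrev Ranking (m : ℕ) : Type := Equiv.Perm (Fin m)

/-- The Kendall tau distance: the number of pairs on which the two rankings disagree. -/
def kendallTau {m : ℕ} (π₁ π₂ : Ranking m) : ℕ :=
  (Finset.univ.filter fun p : Fin m × Fin m => π₁ p.1 < π₁ p.2 ∧ π₂ p.2 < π₂ p.1).card

/-- The average Kendall tau distance (Kemeny score) of `σ` to the `n` rankings `P`. -/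
def kemeny {m n : ℕ} (σ : Ranking m) (P : Fin n → Ranking m) : ℝ :=
  (∑ k, (kendallTau σ (P k) : ℝ)) / n

/-- The optimal (smallest) Kemeny score. -/
def opt {m n : ℕ} (P : Fin n → Ranking m) : ℝ :=
  Finset.univ.inf' Finset.univ_nonempty fun σ : Ranking m => kemeny σ P

/-- Two lists of rankings are neighbouring if they differ in the ranking of one user. -/
def Neighbouring {m n : ℕ} (P P' : Fin n → Ranking m) : Prop :=
  ∃ k, ∀ j, j ≠ k → P j = P' j

/-! ### A probabilistic programming language with a step count

Memory consists of countably many infinite arrays of natural numbers; the name of an array is fixed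
in the program, an index into it may be computed. The only arithmetic operations are addition and
truncated subtraction, so that one step lengthens numbers by a constant number of bits at most, and
the step count below is polynomially related to the running time of a Turing machine. -/

/-- Memory: `M a i` is the content of cell `i` of array `a`. -/
abbrev Memory : Type := ℕ → ℕ → ℕ

/-- Writing the value `v` into cell `i` of array `a`. -/
def Memory.write (M : Memory) (a i v : ℕ) : Memory :=
  Function.update M a (Function.update (M a) i v)

/-- Expressions. -/
inductive Expr : Type
  | lit (v : ℕ)
  | get (a : ℕ) (i : Expr)
  | add (x y : Expr)
  | sub (x y : Expr)

/-- The value of an expression; subtraction is truncated at zero. -/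
def Expr.val (M : Memory) : Expr → ℕ
  | .lit v => v
  | .get a i => M a (i.val M)
  | .add x y => x.val M + y.val M
  | .sub x y => x.val M - y.val M

/-- Commands. -/
inductive Cmd : Type
  /-- do nothing -/
  | skip
  /-- write the value of `v` into cell `i` of array `a` -/
  | set (a : ℕ) (i v : Expr)
  /-- write a uniformly random element of `{0, …, b}` into cell `i` of array `a` -/
  | draw (a : ℕ) (i b : Expr)
  /-- external call with arguments `x` and `y`; the answer is written into cell `i` of array `a` -/
  | call (a : ℕ) (i x y : Expr)
  /-- first `c`, then `d` -/
  | seq (c d : Cmd)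
  /-- if `x` is nonzero then `c`, otherwise `d` -/
  | cond (x : Expr) (c d : Cmd)
  /-- as long as `x` is nonzero, repeat `c` -/
  | loop (x : Expr) (c : Cmd)

/-- What a run records: random draws, and external calls (both arguments and the answer). -/
inductive Event : Type
  | coin (r : ℕ)
  | answer (x y r : ℕ)

/-- The state of a run: the memory and the list of events so far, the latest one first. -/
structure State : Type where
  mem : Memory
  log : List Event

/-- Run the commands in the list `K`, one after the other, for at most `t` steps, where `ext`
answers the external calls. The outcome is `none` if the run needs more than `t` steps, or if one
of its external calls is not answered (has outcome `none`). Executing or unfolding one command is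
one step. -/
def run (ext : ℕ → ℕ → PMF (Option ℕ)) : ℕ → List Cmd → State → PMF (Option State)
  | _, [], s => PMF.pure (some s)
  | 0, _ :: _, _ => PMF.pure none
  | t + 1, .skip :: K, s => run ext t K s
  | t + 1, .set a i v :: K, s =>
      run ext t K ⟨s.mem.write a (i.val s.mem) (v.val s.mem), s.log⟩
  | t + 1, .draw a i b :: K, s =>
      (PMF.uniformOfFintype (Fin (b.val s.mem + 1))).bind fun r =>
        run ext t K ⟨s.mem.write a (i.val s.mem) r, Event.coin r :: s.log⟩
  | t + 1, .call a i x y :: K, s =>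
      (ext (x.val s.mem) (y.val s.mem)).bind fun o =>
        match o with
        | none => PMF.pure none
        | some r =>
            run ext t K ⟨s.mem.write a (i.val s.mem) r,
              Event.answer (x.val s.mem) (y.val s.mem) r :: s.log⟩
  | t + 1, .seq c d :: K, s => run ext t (c :: d :: K) s
  | t + 1, .cond x c d :: K, s => run ext t ((if x.val s.mem ≠ 0 then c else d) :: K) s
  | t + 1, .loop x c :: K, s =>
      run ext t (if x.val s.mem ≠ 0 then c :: .loop x c :: K else K) s

/-- Start with `m`, `n`, `q` in the first three cells of array `0`, zeros elsewhere, and no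
events. -/
def start (m n q : ℕ) : State :=
  ⟨fun a i => if a = 0 then (if i = 0 then m else if i = 1 then n else if i = 2 then q else 0)
    else 0, []⟩

/-- The ranking of `m` items in which item `i` has position `f i`, if this is a ranking. -/
def readRanking (m : ℕ) (f : ℕ → ℕ) : Option (Ranking m) :=
  open Classical in
  if h : ∃ σ : Ranking m, ∀ i : Fin m, f i = (σ i : ℕ) then some h.choose else none

/-! ### Interactive algorithms in the local model -/

/-- An interactive algorithm in the local model: one program for the server and one for the users.
The server never sees a ranking. Its external calls send a message to a user and receive an
answer; whom it asks, and what, may depend on everything that happened before. -/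
structure LocalAlgorithm : Type where
  server : Cmd
  user : Cmd

namespace LocalAlgorithm

/-- The randomized answer of a user with ranking `π` to the message `q`, computed in at most `T`
steps and found in cell `0` of array `1`. The external calls of the user's program look up the
positions of items in the user's own ranking; the random draws are private. -/
def userAnswer (A : LocalAlgorithm) (T : ℕ) {m : ℕ} (n : ℕ) (π : Ranking m) (q : ℕ) :
    PMF (Option ℕ) :=
  (run (fun i _ => PMF.pure (some (if h : i < m then ((π ⟨i, h⟩ : Fin m) : ℕ) else 0)))
    T [A.user] (start m n q)).map (Option.map fun s => s.mem 1 0)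

/-- A run of the algorithm when user `k` holds the ranking `P k`. The server and each answer of a
user may take at most `T` steps. The outcome is the transcript (all messages and answers, and
also all random draws of the server) together with the ranking that the server finally holds in
array `1`; it is `none` if somebody exceeds `T` steps or if array `1` does not hold a ranking. -/
def exec (A : LocalAlgorithm) (T : ℕ) {m n : ℕ} (P : Fin n → Ranking m) :
    PMF (Option (List Event × Ranking m)) :=
  (run (fun k q => if h : k < n then A.userAnswer T n (P ⟨k, h⟩) q else PMF.pure (some 0))
    T [A.server] (start m n 0)).map
      fun o => o.bind fun s => (readRanking m (s.mem 1)).map fun σ => (s.log, σ)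

/-- With `n` users and `m` items, whatever the rankings and the random draws are, the server and
each answer of a user take at most `T` steps, and the server ends up with a ranking. -/
def HaltsWithin (A : LocalAlgorithm) (T m n : ℕ) : Prop :=
  ∀ P : Fin n → Ranking m, A.exec T P none = 0

/-- The distribution of the transcript. -/
def transcript (A : LocalAlgorithm) (T : ℕ) {m n : ℕ} (P : Fin n → Ranking m) :
    PMF (Option (List Event)) :=
  (A.exec T P).map (Option.map Prod.fst)

/-- The distribution of the output ranking. -/
def output (A : LocalAlgorithm) (T : ℕ) {m n : ℕ} (P : Fin n → Ranking m) :
    PMF (Option (Ranking m)) :=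
  (A.exec T P).map (Option.map Prod.snd)

/-- `(ε, δ)`-differential privacy in the local model, for `n` users and `m` items. -/
def IsLocalDP (A : LocalAlgorithm) (T m n : ℕ) (ε δ : ℝ) : Prop :=
  ∀ P P' : Fin n → Ranking m, Neighbouring P P' → ∀ S : Set (Option (List Event)),
    (A.transcript T P).toOuterMeasure S ≤
      ENNReal.ofReal (Real.exp ε) * (A.transcript T P').toOuterMeasure S + ENNReal.ofReal δ

/-- The expected Kemeny score of the output. -/
def expectedScore (A : LocalAlgorithm) (T : ℕ) {m n : ℕ} (P : Fin n → Ranking m) : ℝ :=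
  ∑ σ : Ranking m, (A.output T P (some σ)).toReal * kemeny σ P

/-- `(α, β)`-approximation for rank aggregation, for `n` users and `m` items. -/
def IsApprox (A : LocalAlgorithm) (T m n : ℕ) (α β : ℝ) : Prop :=
  ∀ P : Fin n → Ranking m, A.expectedScore T P ≤ α * opt P + β

end LocalAlgorithm

end RankAgg

end

namespace RankAgg

/-! ### Kendall tau and Spearman's footrule -/

/-! The algorithm is Borda's rule with noise. Let `τ` be an optimal ranking. The footrule distance
is at most twice Kendall tau (`footrule_le`), so the average positions are within `2 * opt P` of `τ`
in the ℓ¹ norm. Sorting any scores `f` gives a ranking whose Kendall distance to `τ` is at most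
twice the ℓ¹ distance of `f` to `τ` (`kendallTau_le_of_sorted`). With the triangle inequality the
cost is at most `(1 + 2 * 2) * opt P` plus twice the ℓ¹ error of the scores (`kemeny_le_of_sorted`).

To estimate average positions privately, each user is asked once, about one uniformly random item,
and returns one bit by randomized response. Only uniform integer draws are needed: the bit `[r <
v]`, with `r` uniform below `m`, has mean `v / m`, and hiding it among `2 * w + 1` outcomes with `w
= ⌈1 / ε⌉₊` changes likelihoods by at most the factor `1 + 1 / w ≤ exp ε` (`respond_private`). Since
every user is polled once and the rest is post-processing, this gives privacy.

Weights `w + 1` and `-w` for the two answers make the scores unbiased up to scaling. A score has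
variance at most `n * (w + 1)² / m`; rescaling by `m² / n` and summing over `m` items gives an error
of order `m ^ (5 / 2) * (w + 1) / √n` (`expected_error_le`).

The other half of the work is that the programs realize this process in an exact number of steps:
`exists_exec_eq` writes a run as a function, independent of the rankings, of `n` successive
independent polls. -/

lemma kendallTau_triangle {m : ℕ} (σ τ π : Ranking m) :
    kendallTau σ π ≤ kendallTau σ τ + kendallTau τ π := by
  unfold kendallTau
  refine le_trans (Finset.card_le_card ?_) (Finset.card_union_le _ _)
  rintro ⟨i, j⟩ h
  simp only [Finset.mem_filter, Finset.mem_univ, true_and, Finset.mem_union] at h ⊢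
  rcases lt_trichotomy (τ i) (τ j) with h1 | h1 | h1
  · exact Or.inr ⟨h1, h.2⟩
  · rw [τ.injective h1] at h
    exact absurd h.1 (lt_irrefl _)
  · exact Or.inl ⟨h.1, h1⟩

lemma kendallTau_eq_sum {m : ℕ} (σ π : Ranking m) :
    kendallTau σ π = ∑ i, (Finset.univ.filter fun j => σ i < σ j ∧ π j < π i).card := by
  unfold kendallTau
  rw [← Finset.univ_product_univ, Finset.card_filter, Finset.sum_product]
  simp_rw [Finset.card_filter]

lemma kendallTau_eq_sum' {m : ℕ} (σ π : Ranking m) :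
    kendallTau σ π = ∑ j, (Finset.univ.filter fun i => σ i < σ j ∧ π j < π i).card := by
  unfold kendallTau
  rw [← Finset.univ_product_univ, Finset.card_filter, Finset.sum_product, Finset.sum_comm]
  simp_rw [Finset.card_filter]

lemma card_filter_perm_lt {m : ℕ} (σ : Ranking m) (i : Fin m) :
    (Finset.univ.filter fun j => σ j < σ i).card = (σ i : ℕ) := by
  have : (Finset.univ.filter fun j => σ j < σ i) = (Finset.Iio (σ i)).map σ.symm.toEmbedding := by
    ext j
    simp
  rw [this, Finset.card_map, Fin.card_Iio]

/-- A position counts the preceding items; an item before `i` in `σ` is before `i` in `π` as well or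
is inverted with it. -/
lemma perm_val_le {m : ℕ} (σ π : Ranking m) (i : Fin m) :
    (σ i : ℕ) ≤ π i + (Finset.univ.filter fun j => σ j < σ i ∧ π i < π j).card := by
  rw [← card_filter_perm_lt σ i, ← card_filter_perm_lt π i]
  refine le_trans (Finset.card_le_card ?_) (Finset.card_union_le _ _)
  intro j h
  simp only [Finset.mem_filter, Finset.mem_univ, true_and, Finset.mem_union] at h ⊢
  rcases lt_trichotomy (π i) (π j) with h1 | h1 | h1
  · exact Or.inr ⟨h, h1⟩
  · rw [π.injective h1] at h
    exact absurd h (lt_irrefl _)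
  · exact Or.inl h1

/-- The footrule distance is at most twice the Kendall tau distance. -/
lemma footrule_le {m : ℕ} (σ π : Ranking m) :
    ∑ i, |((π i : ℕ) : ℝ) - (σ i : ℕ)| ≤ 2 * (kendallTau σ π : ℝ) := by
  -- The displacement of `i` is paid by the inversions involving `i`; each inversion has two
  -- endpoints, whence the factor 2.
  have key : ∀ i, |((π i : ℕ) : ℝ) - (σ i : ℕ)| ≤
      ((Finset.univ.filter fun j => σ i < σ j ∧ π j < π i).card : ℝ) +
        ((Finset.univ.filter fun j => σ j < σ i ∧ π i < π j).card : ℝ) := by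
    intro i
    have h1 : ((σ i : ℕ) : ℝ) ≤ (π i : ℕ) +
        ((Finset.univ.filter fun j => σ j < σ i ∧ π i < π j).card : ℝ) :=
      mod_cast perm_val_le σ π i
    have h2 : ((π i : ℕ) : ℝ) ≤ (σ i : ℕ) +
        ((Finset.univ.filter fun j => π j < π i ∧ σ i < σ j).card : ℝ) :=
      mod_cast perm_val_le π σ i
    simp only [and_comm (a := π _ < π i)] at h2
    rw [abs_le]
    constructor <;> linarith [Nat.cast_nonneg (α := ℝ)
      (Finset.univ.filter fun j => σ i < σ j ∧ π j < π i).card, Nat.cast_nonneg (α := ℝ)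
      (Finset.univ.filter fun j => σ j < σ i ∧ π i < π j).card]
  refine (Finset.sum_le_sum fun i _ => key i).trans (le_of_eq ?_)
  rw [Finset.sum_add_distrib, two_mul]
  congr 1
  · rw [kendallTau_eq_sum]
    push_cast
    rfl
  · rw [kendallTau_eq_sum']
    push_cast
    rfl

lemma card_filter_Ico_le {m : ℕ} (τ : Ranking m) (i : Fin m) (x : ℝ) (hx : 0 ≤ x) :
    ((Finset.univ.filter fun j => τ j < τ i ∧ ((τ i : ℕ) : ℝ) - x ≤ (τ j : ℕ)).card : ℝ) ≤ x := by
  refine le_trans ?_ (Nat.floor_le hx)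
  have : (Finset.univ.filter fun j => τ j < τ i ∧ ((τ i : ℕ) : ℝ) - x ≤ (τ j : ℕ)).card ≤
      (Finset.Ico ((τ i : ℕ) - ⌊x⌋₊) (τ i : ℕ)).card := by
    refine Finset.card_le_card_of_injOn (fun j => (τ j : ℕ)) ?_ ?_
    · intro j hj
      simp only [Finset.coe_filter, Finset.mem_univ, true_and, Set.mem_ofPred_eq] at hj
      have h1 : (τ j : ℕ) < τ i := hj.1
      have h2 : (τ i : ℕ) - (τ j : ℕ) ≤ ⌊x⌋₊ := by
        apply Nat.le_floor
        rw [Nat.cast_sub h1.le]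
        linarith [hj.2]
      simp only [Finset.coe_Ico, Set.mem_Ico]
      omega
    · intro a _ c _ h
      exact τ.injective (Fin.ext h)
  rw [Nat.card_Ico] at this
  exact_mod_cast this.trans (by omega)

lemma card_filter_Ioc_le {m : ℕ} (τ : Ranking m) (i : Fin m) (x : ℝ) (hx : 0 ≤ x) :
    ((Finset.univ.filter fun j => τ i < τ j ∧ ((τ j : ℕ) : ℝ) ≤ (τ i : ℕ) + x).card : ℝ) ≤ x := by
  refine le_trans ?_ (Nat.floor_le hx)
  have : (Finset.univ.filter fun j => τ i < τ j ∧ ((τ j : ℕ) : ℝ) ≤ (τ i : ℕ) + x).card ≤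
      (Finset.Ioc (τ i : ℕ) ((τ i : ℕ) + ⌊x⌋₊)).card := by
    refine Finset.card_le_card_of_injOn (fun j => (τ j : ℕ)) ?_ ?_
    · intro j hj
      simp only [Finset.coe_filter, Finset.mem_univ, true_and, Set.mem_ofPred_eq] at hj
      have h1 : (τ i : ℕ) < τ j := hj.1
      have h2 : (τ j : ℕ) - (τ i : ℕ) ≤ ⌊x⌋₊ := by
        apply Nat.le_floor
        rw [Nat.cast_sub h1.le]
        linarith [hj.2]
      simp only [Finset.coe_Ioc, Set.mem_Ioc]
      omega
    · intro a _ c _ h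
      exact τ.injective (Fin.ext h)
  rw [Nat.card_Ioc] at this
  exact_mod_cast this.trans (by omega)

/-- A ranking that sorts the scores `f` is close to every ranking that is close to `f`. -/
lemma kendallTau_le_of_sorted {m : ℕ} (σ τ : Ranking m) (f : Fin m → ℝ)
    (h : ∀ i j, σ i < σ j → f i ≤ f j) :
    (kendallTau σ τ : ℝ) ≤ 2 * ∑ i, |f i - (τ i : ℕ)| := by
  let A : Fin m → Finset (Fin m) := fun i =>
    Finset.univ.filter fun j => τ j < τ i ∧ ((τ i : ℕ) : ℝ) - 2 * ((τ i : ℕ) - f i) ≤ (τ j : ℕ)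
  let B : Fin m → Finset (Fin m) := fun i =>
    Finset.univ.filter fun j => τ i < τ j ∧ ((τ j : ℕ) : ℝ) ≤ (τ i : ℕ) + 2 * (f i - (τ i : ℕ))
  have hsub : (Finset.univ.filter fun p : Fin m × Fin m => σ p.1 < σ p.2 ∧ τ p.2 < τ p.1) ⊆
      (Finset.univ.filter fun p : Fin m × Fin m => p.2 ∈ A p.1) ∪
        (Finset.univ.filter fun p : Fin m × Fin m => p.1 ∈ B p.2) := by
    rintro ⟨i, j⟩ hp
    simp only [Finset.mem_filter, Finset.mem_univ, true_and, Finset.mem_union, A, B] at hp ⊢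
    have h1 := h i j hp.1
    -- Here `τ j < τ i` but `f i ≤ f j`. Relative to the midpoint of `τ i` and `τ j`, either `f i`
    -- is not above it or `f j` is above it: one of the two scores is off by at least half the gap,
    -- and the pair is charged to that item.
    by_cases h2 : 2 * f i ≤ (τ i : ℕ) + (τ j : ℕ)
    · exact Or.inl ⟨hp.2, by linarith⟩
    · exact Or.inr ⟨hp.2, by linarith⟩
  have hcard : kendallTau σ τ ≤ ∑ i, ((A i).card + (B i).card) := by
    refine (Finset.card_le_card hsub).trans ((Finset.card_union_le _ _).trans (le_of_eq ?_))
    rw [Finset.sum_add_distrib, ← Finset.univ_product_univ, Finset.card_filter,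
      Finset.card_filter, Finset.sum_product, Finset.sum_product_right]
    congr 1 <;>
    · refine Finset.sum_congr rfl fun i _ => ?_
      rw [← Finset.card_filter]
      simp only [Finset.filter_mem_eq_inter, Finset.univ_inter]
  -- The score errs on one side only, so one of the two windows is empty.
  have hpt : ∀ i, ((A i).card : ℝ) + (B i).card ≤ 2 * |f i - (τ i : ℕ)| := by
    intro i
    rcases le_total (f i) (τ i : ℕ) with hi | hi
    · have hB : B i = ∅ := by
        refine Finset.filter_eq_empty_iff.2 fun j _ hj => ?_
        have : ((τ i : ℕ) : ℝ) < (τ j : ℕ) := mod_cast hj.1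
        linarith [hj.2]
      rw [hB, abs_of_nonpos (by linarith), Finset.card_empty, Nat.cast_zero, add_zero]
      have := card_filter_Ico_le τ i (2 * ((τ i : ℕ) - f i)) (by linarith)
      linarith
    · have hA : A i = ∅ := by
        refine Finset.filter_eq_empty_iff.2 fun j _ hj => ?_
        have : ((τ j : ℕ) : ℝ) < (τ i : ℕ) := mod_cast hj.1
        linarith [hj.2]
      rw [hA, abs_of_nonneg (by linarith), Finset.card_empty, Nat.cast_zero, zero_add]
      exact card_filter_Ioc_le τ i (2 * (f i - (τ i : ℕ))) (by linarith)
  calc (kendallTau σ τ : ℝ) ≤ ((∑ i, ((A i).card + (B i).card) : ℕ) : ℝ) := mod_cast hcard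
    _ = ∑ i, (((A i).card : ℝ) + (B i).card) := by push_cast; rfl
    _ ≤ ∑ i, 2 * |f i - (τ i : ℕ)| := Finset.sum_le_sum fun i _ => hpt i
    _ = _ := by rw [Finset.mul_sum]

/-- The average position of an item. -/
noncomputable def borda {m n : ℕ} (P : Fin n → Ranking m) (i : Fin m) : ℝ :=
  (∑ k, ((P k i : ℕ) : ℝ)) / n

lemma opt_nonneg {m n : ℕ} (P : Fin n → Ranking m) : 0 ≤ opt P := by
  refine (Finset.le_inf'_iff _ _).2 fun σ _ => ?_
  unfold kemeny
  positivity

lemma sum_abs_borda_sub_le {m n : ℕ} (hn : 1 ≤ n) (P : Fin n → Ranking m) (τ : Ranking m) :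
    ∑ i, |borda P i - (τ i : ℕ)| ≤ 2 * kemeny τ P := by
  have hn0 : (0 : ℝ) < n := by exact_mod_cast hn
  have h1 : ∀ i, |borda P i - (τ i : ℕ)| ≤ (∑ k, |((P k i : ℕ) : ℝ) - (τ i : ℕ)|) / n := by
    intro i
    have : borda P i - (τ i : ℕ) = (∑ k, (((P k i : ℕ) : ℝ) - (τ i : ℕ))) / n := by
      unfold borda
      rw [Finset.sum_sub_distrib, Finset.sum_const, Finset.card_univ, Fintype.card_fin,
        nsmul_eq_mul]
      field_simp
    rw [this, abs_div, abs_of_pos hn0]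
    gcongr
    exact Finset.abs_sum_le_sum_abs _ _
  refine (Finset.sum_le_sum fun i _ => h1 i).trans ?_
  rw [← Finset.sum_div, Finset.sum_comm, kemeny, ← mul_div_assoc, Finset.mul_sum]
  gcongr with k
  exact footrule_le τ (P k)

/-- Sorting by approximate average positions is a `5`-approximation up to the error of the
approximation. -/
lemma kemeny_le_of_sorted {m n : ℕ} (hn : 1 ≤ n) (P : Fin n → Ranking m) (σ : Ranking m)
    (f : Fin m → ℝ) (h : ∀ i j, σ i < σ j → f i ≤ f j) :
    kemeny σ P ≤ 5 * opt P + 2 * ∑ i, |f i - borda P i| := by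
  have hn0 : (0 : ℝ) < n := by exact_mod_cast hn
  obtain ⟨τ, -, hτ⟩ := Finset.exists_mem_eq_inf' Finset.univ_nonempty
    fun σ : Ranking m => kemeny σ P
  have hopt : opt P = kemeny τ P := hτ
  have h1 : kemeny σ P ≤ kendallTau σ τ + kemeny τ P := by
    unfold kemeny
    rw [div_le_iff₀ hn0, add_mul, div_mul_cancel₀ _ hn0.ne']
    calc ∑ k, (kendallTau σ (P k) : ℝ)
        ≤ ∑ k, ((kendallTau σ τ : ℝ) + kendallTau τ (P k)) :=
          Finset.sum_le_sum fun k _ => mod_cast kendallTau_triangle σ τ (P k)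
      _ = _ := by
          rw [Finset.sum_add_distrib, Finset.sum_const, Finset.card_univ, Fintype.card_fin,
            nsmul_eq_mul, mul_comm]
  have h2 := kendallTau_le_of_sorted σ τ f h
  have h3 : ∑ i, |f i - (τ i : ℕ)| ≤ ∑ i, |f i - borda P i| + ∑ i, |borda P i - (τ i : ℕ)| := by
    rw [← Finset.sum_add_distrib]
    exact Finset.sum_le_sum fun i _ => abs_sub_le _ _ _
  have h4 := sum_abs_borda_sub_le hn P τ
  rw [hopt]
  linarith

/-! ### Ranking by keys -/

/-- Counting smaller keys is strictly monotone in the key, hence injective on `Fin m`. This is the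
form in which the server computes positions. -/
lemma exists_ranking_of_key {m : ℕ} {κ : Type*} [LinearOrder κ] (key : Fin m → κ)
    (hkey : Function.Injective key) :
    ∃ σ : Ranking m, (∀ i, (σ i : ℕ) = (Finset.univ.filter fun j => key j < key i).card) ∧
      ∀ i j, σ i < σ j → key i < key j := by
  have hlt : ∀ i, (Finset.univ.filter fun j => key j < key i).card < m := by
    intro i
    have : (Finset.univ.filter fun j => key j < key i) ⊂ Finset.univ := by
      refine Finset.filter_ssubset.2 ⟨i, Finset.mem_univ _, lt_irrefl _⟩
    simpa using Finset.card_lt_card this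
  have hmono : ∀ i j, key i < key j → (Finset.univ.filter fun l => key l < key i).card <
      (Finset.univ.filter fun l => key l < key j).card := by
    intro i j hij
    refine Finset.card_lt_card (Finset.ssubset_iff_subset_ne.2 ⟨fun l hl => ?_, fun he => ?_⟩)
    · simp only [Finset.mem_filter, Finset.mem_univ, true_and] at hl ⊢
      exact hl.trans hij
    · have : i ∈ Finset.univ.filter fun l => key l < key j := by simpa using hij
      rw [← he] at this
      simp at this
  let g : Fin m → Fin m := fun i => ⟨_, hlt i⟩
  have hg : Function.Injective g := by
    intro i j hij
    have hij' := Fin.ext_iff.1 hij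
    rcases lt_trichotomy (key i) (key j) with h | h | h
    · exact absurd hij' (hmono i j h).ne
    · exact hkey h
    · exact absurd hij' (hmono j i h).ne'
  refine ⟨Equiv.ofBijective g (Finite.injective_iff_bijective.1 hg), fun i => rfl, ?_⟩
  intro i j hij
  by_contra hc
  rcases (not_lt.1 hc).lt_or_eq with h | h
  · exact absurd (hmono j i h) (not_lt.2 (le_of_lt hij))
  · rw [hkey h] at hij
    exact lt_irrefl _ hij

lemma readRanking_eq_some {m : ℕ} (f : ℕ → ℕ) (σ : Ranking m) (h : ∀ i : Fin m, f i = (σ i : ℕ)) :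
    readRanking m f = some σ := by
  have hex : ∃ σ : Ranking m, ∀ i : Fin m, f i = (σ i : ℕ) := ⟨σ, h⟩
  rw [readRanking, dif_pos hex]
  refine congrArg some (Equiv.ext fun i => Fin.ext ?_)
  rw [← hex.choose_spec i, h i]

/-! ### Running programs -/

/-- The uniform distribution on `{0, …, b}`. -/
noncomputable def unif (b : ℕ) : PMF ℕ := (PMF.uniformOfFintype (Fin (b + 1))).map Fin.val

section Run

variable (ext : ℕ → ℕ → PMF (Option ℕ)) (t : ℕ) (K : List Cmd) (s : State)

lemma run_nil : run ext t [] s = PMF.pure (some s) := by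
  cases t <;> rfl

lemma run_set (a : ℕ) (i v : Expr) : run ext (t + 1) (.set a i v :: K) s =
    run ext t K ⟨s.mem.write a (i.val s.mem) (v.val s.mem), s.log⟩ := rfl

lemma run_draw (a : ℕ) (i b : Expr) : run ext (t + 1) (.draw a i b :: K) s =
    (unif (b.val s.mem)).bind fun r =>
      run ext t K ⟨s.mem.write a (i.val s.mem) r, Event.coin r :: s.log⟩ := by
  rw [unif, PMF.bind_map]
  rfl

lemma run_call (a : ℕ) (i x y : Expr) (D : PMF ℕ)
    (h : ext (x.val s.mem) (y.val s.mem) = D.map some) :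
    run ext (t + 1) (.call a i x y :: K) s = D.bind fun r =>
      run ext t K ⟨s.mem.write a (i.val s.mem) r,
        Event.answer (x.val s.mem) (y.val s.mem) r :: s.log⟩ := by
  rw [run, h, PMF.bind_map]
  rfl

lemma run_seq (c d : Cmd) : run ext (t + 1) (.seq c d :: K) s = run ext t (c :: d :: K) s := rfl

lemma run_cond (x : Expr) (c d : Cmd) : run ext (t + 1) (.cond x c d :: K) s =
    run ext t ((if x.val s.mem ≠ 0 then c else d) :: K) s := rfl

lemma run_loop_of_ne (x : Expr) (c : Cmd) (h : x.val s.mem ≠ 0) :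
    run ext (t + 1) (.loop x c :: K) s = run ext t (c :: .loop x c :: K) s := by
  rw [run, if_pos h]

lemma run_loop_of_eq (x : Expr) (c : Cmd) (h : x.val s.mem = 0) :
    run ext (t + 1) (.loop x c :: K) s = run ext t K s := by
  rw [run, if_neg (not_not.2 h)]

end Run

/-- Lets an invariant of the reachable states be used when continuing a run. -/
lemma pmf_bind_congr {α β : Type*} (p : PMF α) (f g : α → PMF β)
    (h : ∀ a ∈ p.support, f a = g a) : p.bind f = p.bind g := by
  ext b
  rw [PMF.bind_apply, PMF.bind_apply]
  refine tsum_congr fun a => ?_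
  by_cases ha : p a = 0
  · rw [ha, zero_mul, zero_mul]
  · rw [h a ((PMF.mem_support_iff _ _).2 ha)]

/-- From state `s`, the command `c` takes exactly `N` steps and leaves a state with
distribution `D`. -/
def Runs (ext : ℕ → ℕ → PMF (Option ℕ)) (c : Cmd) (s : State) (N : ℕ) (D : PMF State) : Prop :=
  ∀ t K, run ext (t + N) (c :: K) s = D.bind fun s' => run ext t K s'

/-- From state `s`, the command `c` makes no external calls and no draws, takes exactly `N` steps
and leaves the state `s'`. -/
def Leads (c : Cmd) (s : State) (N : ℕ) (s' : State) : Prop :=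
  ∀ ext t K, run ext (t + N) (c :: K) s = run ext t K s'

lemma Leads.seq {c d : Cmd} {s s' s'' : State} {N N' : ℕ} (h : Leads c s N s')
    (h' : Leads d s' N' s'') : Leads (.seq c d) s (N + N' + 1) s'' := by
  intro ext t K
  rw [show t + (N + N' + 1) = (t + N') + N + 1 by omega, run_seq, h, h']

lemma leads_set (a : ℕ) (i v : Expr) (s : State) :
    Leads (.set a i v) s 1 ⟨s.mem.write a (i.val s.mem) (v.val s.mem), s.log⟩ :=
  fun _ _ _ => rfl

/-- Loop rule with exact cost: each round adds one step for the test, and the failing last test adds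
one more. -/
lemma leads_loop {x : Expr} {c : Cmd} {N n : ℕ} (Inv : ℕ → State → Prop)
    (hstep : ∀ k < n, ∀ s, Inv k s → x.val s.mem ≠ 0 ∧ ∃ s', Leads c s N s' ∧ Inv (k + 1) s')
    (hend : ∀ s, Inv n s → x.val s.mem = 0) :
    ∀ r k s, k + r = n → Inv k s → ∃ s', Leads (.loop x c) s (r * (N + 1) + 1) s' ∧ Inv n s' := by
  intro r
  induction r with
  | zero =>
    rintro k s rfl hs
    exact ⟨s, fun ext t K => by simpa using run_loop_of_eq ext t K s x c (hend s hs), hs⟩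
  | succ r ih =>
    intro k s hk hs
    obtain ⟨hx, s₁, h₁, hs₁⟩ := hstep k (by omega) s hs
    obtain ⟨s₂, h₂, hs₂⟩ := ih (k + 1) s₁ (by omega) hs₁
    refine ⟨s₂, fun ext t K => ?_, hs₂⟩
    rw [show t + ((r + 1) * (N + 1) + 1) = (t + (r * (N + 1) + 1)) + N + 1 by ring,
      run_loop_of_ne _ _ _ _ _ _ hx, h₁, h₂]

/-! ### Sequential independent sampling: likelihood ratios and moments -/

section Fold

variable {α S : Type*}

/-- Starting from `s`, update the state with `r` independent samples, drawn from
`q k, …, q (k + r - 1)`. -/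
noncomputable def foldPMF (q : ℕ → PMF α) (u : S → α → S) : ℕ → ℕ → S → PMF S
  | 0, _, s => PMF.pure s
  | r + 1, k, s => (q k).bind fun a => foldPMF q u r (k + 1) (u s a)

lemma foldPMF_support (q : ℕ → PMF α) (u : S → α → S) (Inv : ℕ → S → Prop)
    (h : ∀ k s a, Inv k s → Inv (k + 1) (u s a)) :
    ∀ r k s, Inv k s → ∀ s' ∈ (foldPMF q u r k s).support, Inv (k + r) s' := by
  intro r
  induction r with
  | zero =>
    intro k s hs s' hs'
    rw [foldPMF, PMF.support_pure, Set.mem_singleton_iff] at hs'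
    rwa [hs']
  | succ r ih =>
    intro k s hs s' hs'
    rw [foldPMF, PMF.mem_support_bind_iff] at hs'
    obtain ⟨a, -, ha⟩ := hs'
    have := ih (k + 1) (u s a) (h k s a hs) s' ha
    rwa [show k + 1 + r = k + (r + 1) by omega] at this

/-- Likelihood ratios multiply over the rounds; this is the composition step of the privacy proof.
-/
lemma foldPMF_le (q q' : ℕ → PMF α) (u : S → α → S) (c : ℕ → ENNReal)
    (h : ∀ k a, q k a ≤ c k * q' k a) :
    ∀ r k s x, foldPMF q u r k s x ≤ (∏ l ∈ Finset.Ico k (k + r), c l) * foldPMF q' u r k s x := by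
  intro r
  induction r with
  | zero =>
    intro k s x
    simp [foldPMF]
  | succ r ih =>
    intro k s x
    rw [foldPMF, foldPMF, PMF.bind_apply, PMF.bind_apply, ← ENNReal.tsum_mul_left]
    refine ENNReal.tsum_le_tsum fun a => ?_
    refine (mul_le_mul' (h k a) (ih (k + 1) (u s a) x)).trans (le_of_eq ?_)
    rw [Finset.prod_eq_prod_Ico_succ_bot (by omega : k < k + (r + 1)),
      show k + 1 + r = k + (r + 1) by omega]
    ring

/-- The expectation of `φ` under `foldPMF`, as a finite sum. -/
noncomputable def foldExp [Fintype α] (q : ℕ → PMF α) (u : S → α → S) (φ : S → ℝ) :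
    ℕ → ℕ → S → ℝ
  | 0, _, s => φ s
  | r + 1, k, s => ∑ a, (q k a).toReal * foldExp q u φ r (k + 1) (u s a)

lemma sum_toReal [Fintype α] (p : PMF α) : ∑ a, (p a).toReal = 1 := by
  rw [← ENNReal.toReal_sum fun a _ => p.apply_ne_top a, ← tsum_fintype (L := .unconditional _),
    p.tsum_coe, ENNReal.toReal_one]

lemma toReal_bind_apply [Fintype α] {β : Type*} (p : PMF α) (f : α → PMF β) (b : β) :
    ((p.bind f) b).toReal = ∑ a, (p a).toReal * (f a b).toReal := by
  rw [PMF.bind_apply, tsum_fintype, ENNReal.toReal_sum]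
  · simp_rw [ENNReal.toReal_mul]
  · exact fun a _ => ENNReal.mul_ne_top (p.apply_ne_top a) ((f a).apply_ne_top b)

/-- States form an infinite type; iterated finite sums over the samples avoid all summability
questions. -/
lemma sum_map_foldPMF [Fintype α] {β : Type*} [Fintype β] (q : ℕ → PMF α) (u : S → α → S)
    (g : S → β) (F : β → ℝ) : ∀ r k s,
    ∑ b, (((foldPMF q u r k s).map g) b).toReal * F b = foldExp q u (fun s => F (g s)) r k s := by
  classical
  intro r
  induction r with
  | zero =>
    intro k s
    rw [foldPMF, PMF.pure_map, foldExp, Finset.sum_eq_single (g s)]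
    · simp
    · intro b _ hb
      simp [PMF.pure_apply, hb]
    · simp
  | succ r ih =>
    intro k s
    rw [foldPMF, PMF.map_bind, foldExp]
    simp_rw [toReal_bind_apply, ← ih, Finset.sum_mul, Finset.mul_sum]
    rw [Finset.sum_comm]
    simp_rw [mul_assoc]

lemma foldExp_mono [Fintype α] (q : ℕ → PMF α) (u : S → α → S) (φ ψ : S → ℝ)
    (Inv : ℕ → S → Prop) (h : ∀ k s a, Inv k s → Inv (k + 1) (u s a)) (n : ℕ)
    (hle : ∀ s, Inv n s → φ s ≤ ψ s) : ∀ r k s, k + r = n → Inv k s →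
    foldExp q u φ r k s ≤ foldExp q u ψ r k s := by
  intro r
  induction r with
  | zero =>
    rintro k s rfl hs
    exact hle s hs
  | succ r ih =>
    intro k s hk hs
    rw [foldExp, foldExp]
    refine Finset.sum_le_sum fun a _ => ?_
    exact mul_le_mul_of_nonneg_left (ih (k + 1) (u s a) (by omega) (h k s a hs))
      ENNReal.toReal_nonneg

lemma foldExp_add [Fintype α] (q : ℕ → PMF α) (u : S → α → S) (φ ψ : S → ℝ) : ∀ r k s,
    foldExp q u (fun s => φ s + ψ s) r k s = foldExp q u φ r k s + foldExp q u ψ r k s := by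
  intro r
  induction r with
  | zero => intro k s; rfl
  | succ r ih =>
    intro k s
    simp_rw [foldExp, ih, mul_add, Finset.sum_add_distrib]

lemma foldExp_mul [Fintype α] (q : ℕ → PMF α) (u : S → α → S) (c : ℝ) (φ : S → ℝ) : ∀ r k s,
    foldExp q u (fun s => c * φ s) r k s = c * foldExp q u φ r k s := by
  intro r
  induction r with
  | zero => intro k s; rfl
  | succ r ih =>
    intro k s
    simp_rw [foldExp, ih, Finset.mul_sum]
    exact Finset.sum_congr rfl fun a _ => by ring

lemma foldExp_const [Fintype α] (q : ℕ → PMF α) (u : S → α → S) (c : ℝ) : ∀ r k s,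
    foldExp q u (fun _ => c) r k s = c := by
  intro r
  induction r with
  | zero => intro k s; rfl
  | succ r ih =>
    intro k s
    simp_rw [foldExp, ih, ← Finset.sum_mul, sum_toReal, one_mul]

lemma foldExp_sum [Fintype α] {ι : Type*} (q : ℕ → PMF α) (u : S → α → S) (I : Finset ι)
    (φ : ι → S → ℝ) (r k : ℕ) (s : S) :
    foldExp q u (fun s => ∑ i ∈ I, φ i s) r k s = ∑ i ∈ I, foldExp q u (φ i) r k s := by
  classical
  induction I using Finset.induction_on with
  | empty => simpa using foldExp_const q u 0 r k s
  | insert i I hi ih => simp_rw [Finset.sum_insert hi, foldExp_add, ih]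

/-- The second moment of a sum of independent samples. -/
lemma foldExp_sq_le [Fintype α] (q : ℕ → PMF α) (u : S → α → S) (f : S → ℝ) (y : α → ℝ)
    (hf : ∀ s a, f (u s a) = f s + y a) (μ : ℕ → ℝ) (V : ℝ) (n : ℕ)
    (hμ : ∀ k < n, ∑ a, (q k a).toReal * y a = μ k)
    (hV : ∀ k < n, ∑ a, (q k a).toReal * y a ^ 2 ≤ V) (x : ℝ) : ∀ r k s, k + r = n →
    foldExp q u (fun s => (f s - x) ^ 2) r k s ≤
      (f s + ∑ l ∈ Finset.Ico k n, μ l - x) ^ 2 + r * V := by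
  intro r
  induction r with
  | zero =>
    rintro k s rfl
    simp [foldExp]
  | succ r ih =>
    intro k s hk
    have hk' : k < n := by omega
    rw [foldExp, Finset.sum_eq_sum_Ico_succ_bot hk']
    set A := f s + ∑ l ∈ Finset.Ico (k + 1) n, μ l - x with hA
    calc ∑ a, (q k a).toReal * foldExp q u (fun s => (f s - x) ^ 2) r (k + 1) (u s a)
        ≤ ∑ a, (q k a).toReal * ((A + y a) ^ 2 + r * V) := by
          refine Finset.sum_le_sum fun a _ => mul_le_mul_of_nonneg_left ?_ ENNReal.toReal_nonneg
          refine (ih (k + 1) (u s a) (by omega)).trans (le_of_eq ?_)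
          rw [hf, hA]
          ring
      _ = (A ^ 2 + r * V) * ∑ a, (q k a).toReal + 2 * A * ∑ a, (q k a).toReal * y a +
            ∑ a, (q k a).toReal * y a ^ 2 := by
          rw [Finset.mul_sum, Finset.mul_sum, ← Finset.sum_add_distrib, ← Finset.sum_add_distrib]
          exact Finset.sum_congr rfl fun a _ => by ring
      -- The second moment replaces the variance: the term `μ k ^ 2` is given away.
      _ ≤ (A + μ k) ^ 2 + (r + 1) * V := by
          rw [sum_toReal, hμ k hk']
          nlinarith [hV k hk', sq_nonneg (μ k)]
      _ = _ := by
          rw [hA]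
          push_cast
          ring

/-- Jensen's inequality through the pointwise bound `|φ| ≤ φ² / (2 * b) + b / 2`. -/
lemma foldExp_abs_le [Fintype α] (q : ℕ → PMF α) (u : S → α → S) (φ : S → ℝ) (r k : ℕ) (s : S)
    (b : ℝ) (hb : 0 < b) (h : foldExp q u (fun s => φ s ^ 2) r k s ≤ b ^ 2) :
    foldExp q u (fun s => |φ s|) r k s ≤ b := by
  have h1 : foldExp q u (fun s => |φ s|) r k s ≤
      foldExp q u (fun s => 1 / (2 * b) * φ s ^ 2 + b / 2) r k s := by
    refine foldExp_mono q u _ _ (fun _ _ => True) (fun _ _ _ _ => trivial) (k + r)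
      (fun s _ => ?_) r k s rfl trivial
    have h2 : (1 / (2 * b) * φ s ^ 2 + b / 2) = (φ s ^ 2 + b ^ 2) / (2 * b) := by
      field_simp
    rw [h2, le_div_iff₀ (by positivity), ← sq_abs (φ s)]
    nlinarith [sq_nonneg (|φ s| - b)]
  refine h1.trans ?_
  rw [foldExp_add, foldExp_mul, foldExp_const]
  have h3 : 1 / (2 * b) * foldExp q u (fun s => φ s ^ 2) r k s ≤ 1 / (2 * b) * b ^ 2 := by
    gcongr
  have h4 : 1 / (2 * b) * b ^ 2 = b / 2 := by
    field_simp
  linarith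

end Fold

lemma runs_loop {α : Type*} {ext : ℕ → ℕ → PMF (Option ℕ)} {x : Expr} {c : Cmd} {N n : ℕ}
    (Inv : ℕ → State → Prop) (q : ℕ → PMF α) (u : State → α → State)
    (hstep : ∀ k < n, ∀ s, Inv k s → x.val s.mem ≠ 0 ∧ Runs ext c s N ((q k).map (u s)))
    (hInv : ∀ k s a, Inv k s → Inv (k + 1) (u s a))
    (hend : ∀ s, Inv n s → x.val s.mem = 0) :
    ∀ r k s, k + r = n → Inv k s →
      Runs ext (.loop x c) s (r * (N + 1) + 1) (foldPMF q u r k s) := by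
  intro r
  induction r with
  | zero =>
    rintro k s rfl hs t K
    rw [foldPMF, PMF.pure_bind]
    simpa using run_loop_of_eq ext t K s x c (hend s hs)
  | succ r ih =>
    intro k s hk hs t K
    obtain ⟨hx, h₁⟩ := hstep k (by omega) s hs
    rw [show t + ((r + 1) * (N + 1) + 1) = (t + (r * (N + 1) + 1)) + N + 1 by ring,
      run_loop_of_ne _ _ _ _ _ _ hx, h₁, PMF.bind_map, foldPMF, PMF.bind_bind]
    refine congrArg _ (funext fun a => ?_)
    exact ih (k + 1) (u s a) (by omega) (hInv k s a hs) t K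

/-! ### The noisy Borda algorithm -/

lemma Memory.write_apply (M : Memory) (a i v c j : ℕ) :
    M.write a i v c j = if c = a ∧ j = i then v else M c j := by
  unfold Memory.write
  by_cases hc : c = a
  · subst hc
    by_cases hj : j = i
    · subst hj
      simp
    · simp [hj]
  · simp [hc]

/-- Randomized response: a bit that equals `1` with probability `(w + v / (b + 1)) / (2 * w + 1)`. -/
noncomputable def respond (w b v : ℕ) : PMF Bool :=
  (unif b).bind fun r => (unif (2 * w)).map fun s => decide (s < w + if r < v then 1 else 0)

/-- The cell `i` of array `0`. -/
def Expr.reg (i : ℕ) : Expr := .get 0 (.lit i)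

/-- The users' program: randomized response for the position of the item in the message. -/
def bordaUser (w : ℕ) : Cmd :=
  .seq (.draw 2 (.lit 0) (.sub (.reg 0) (.lit 1)))
    (.seq (.draw 2 (.lit 1) (.lit (2 * w)))
      (.seq (.call 2 (.lit 2) (.reg 2) (.lit 0))
        (.set 1 (.lit 0)
          -- With truncated subtraction, `1 - (1 - x)` is the indicator of `x ≠ 0`; nested, this
          -- computes `[s < w + [r < v]]`.
          (.sub (.lit 1) (.sub (.lit 1) (.sub
            (.add (.lit w) (.sub (.lit 1) (.sub (.lit 1)
              (.sub (.get 2 (.lit 2)) (.get 2 (.lit 0))))))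
            (.get 2 (.lit 1))))))))

/-- Ask user `k` about a random item and update the score of this item. -/
def pollUser (w : ℕ) : Cmd :=
  .seq (.draw 0 (.lit 4) (.sub (.reg 0) (.lit 1)))
    (.seq (.call 0 (.lit 5) (.reg 3) (.reg 4))
      (.seq
        -- The weights `w + 1` and `-w` undo the bias of randomized response. Memory holds naturals,
        -- so negative contributions accumulate in array `3`.
        (.cond (.reg 5)
          (.set 2 (.reg 4) (.add (.get 2 (.reg 4)) (.lit (w + 1))))
          (.set 3 (.reg 4) (.add (.get 3 (.reg 4)) (.lit w))))
        (.set 0 (.lit 3) (.add (.reg 3) (.lit 1)))))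

/-- Increase the position of item `i` if item `j` has to precede it. -/
def compareItems : Cmd :=
  -- Scores are differences, so they are compared after moving the negative parts across: `A < B`
  -- says that `j` has the smaller score. The second summand below is nonzero exactly when `A ≤ B`
  -- and `j < i`, which breaks ties by index.
  let A : Expr := .add (.get 2 (.reg 7)) (.get 3 (.reg 6))
  let B : Expr := .add (.get 2 (.reg 6)) (.get 3 (.reg 7))
  .seq
    (.set 1 (.reg 6) (.add (.get 1 (.reg 6))
      (.sub (.lit 1) (.sub (.lit 1) (.add (.sub B A)
        (.sub (.lit 1) (.add (.sub (.lit 1) (.sub (.reg 6) (.reg 7))) (.sub A B))))))))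
    (.set 0 (.lit 7) (.add (.reg 7) (.lit 1)))

/-- Compute the position of item `i`. -/
def placeItem : Cmd :=
  .seq (.set 0 (.lit 7) (.lit 0))
    (.seq (.loop (.sub (.reg 0) (.reg 7)) compareItems)
      (.set 0 (.lit 6) (.add (.reg 6) (.lit 1))))

/-- Compute the positions of all items. -/
def sortItems : Cmd := .loop (.sub (.reg 0) (.reg 6)) placeItem

/-- Estimate the average position of each item by polling every user about one random item, and
sort the items by these estimates. -/
def bordaAlgorithm (w : ℕ) : LocalAlgorithm where
  -- In array `0`, cell `3` is the next user, `4` and `5` the item asked about and the answer, `6`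
  -- and `7` the items being compared. The counters `3` and `6` rely on memory being zero at the
  -- start.
  server := .seq (.loop (.sub (.reg 1) (.reg 3)) (pollUser w)) sortItems
  user := bordaUser w

lemma userAnswer_bordaAlgorithm (w T b n : ℕ) (hT : 7 ≤ T) (π : Ranking (b + 1))
    (i : Fin (b + 1)) :
    (bordaAlgorithm w).userAnswer T n π i =
      ((respond w b (π i)).map fun z => if z then 1 else 0).map some := by
  obtain ⟨t, rfl⟩ : ∃ t, T = t + 7 := ⟨T - 7, by omega⟩
  unfold LocalAlgorithm.userAnswer bordaAlgorithm bordaUser respond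
  simp only [run_seq, run_draw, PMF.map_bind, PMF.map_comp]
  have hb : Expr.val (start (b + 1) n i).mem ((Expr.reg 0).sub (.lit 1)) = b := by
    simp [Expr.val, Expr.reg, start]
  rw [hb]
  refine congrArg _ (funext fun r => ?_)
  rw [show Expr.val _ (.lit (2 * w)) = 2 * w from rfl, ← PMF.bind_pure_comp]
  refine congrArg _ (funext fun s => ?_)
  rw [run_call _ _ _ _ _ _ _ _ (PMF.pure (π i))]
  · rw [PMF.pure_bind, run_set, run_nil, PMF.pure_map]
    simp only [Function.comp_apply, Option.map_some, Expr.val, Memory.write_apply]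
    congr 2
    by_cases h1 : r < (π i : ℕ)
    · by_cases h2 : s < w + 1
      · simp [h1, h2]
        omega
      · simp [h1, h2]
        omega
    · by_cases h2 : s < w
      · simp [h1, h2]
        omega
      · simp [h1, h2]
        omega
  · rw [PMF.pure_map]
    have hi := Nat.lt_succ_iff.1 i.2
    simp [Expr.val, Expr.reg, Memory.write_apply, start, hi]

/-- The position of item `i` in the ranking of user `k`. -/
def position {b n : ℕ} (P : Fin n → Ranking (b + 1)) (k : ℕ) (i : Fin (b + 1)) : ℕ :=
  if h : k < n then P ⟨k, h⟩ i else 0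

/-- The item that user `k` is asked about, and the answer. -/
noncomputable def poll (w : ℕ) {b n : ℕ} (P : Fin n → Ranking (b + 1)) (k : ℕ) :
    PMF (Fin (b + 1) × Bool) :=
  (PMF.uniformOfFintype (Fin (b + 1))).bind fun i =>
    (respond w b (position P k i)).map (Prod.mk i)

/-- The effect of `pollUser` on the server's state. -/
def record (w : ℕ) {b : ℕ} (s : State) (a : Fin (b + 1) × Bool) : State :=
  let z := if a.2 then 1 else 0
  let M := (s.mem.write 0 4 a.1).write 0 5 z
  let M' := if a.2 then M.write 2 a.1 (M 2 a.1 + (w + 1)) else M.write 3 a.1 (M 3 a.1 + w)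
  ⟨M'.write 0 3 (M' 0 3 + 1), .answer (s.mem 0 3) a.1 z :: .coin a.1 :: s.log⟩

/-- The state of the server after polling `k` users. -/
def Polled (b n k : ℕ) (s : State) : Prop :=
  s.mem 0 0 = b + 1 ∧ s.mem 0 1 = n ∧ s.mem 0 3 = k ∧ s.mem 0 6 = 0 ∧ ∀ i, s.mem 1 i = 0

/-- The score of item `i`. -/
def score {b : ℕ} (s : State) (i : Fin (b + 1)) : ℤ := (s.mem 2 i : ℤ) - s.mem 3 i

lemma polled_record (w b n k : ℕ) (s : State) (a : Fin (b + 1) × Bool) (h : Polled b n k s) :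
    Polled b n (k + 1) (record w s a) := by
  obtain ⟨h0, h1, h3, h6, hi⟩ := h
  obtain ⟨i, z⟩ := a
  cases z <;> simp [Polled, record, Memory.write_apply, h0, h1, h3, h6, hi]

lemma score_record (w : ℕ) {b : ℕ} (s : State) (a : Fin (b + 1) × Bool) (i : Fin (b + 1)) :
    score (record w s a) i =
      score s i + if a.1 = i then (if a.2 then (w + 1 : ℤ) else -w) else 0 := by
  obtain ⟨j, z⟩ := a
  by_cases hij : j = i
  · subst hij
    cases z
    · simp [score, record, Memory.write_apply]
      ring
    · simp [score, record, Memory.write_apply]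
      ring
  · have : (i : ℕ) ≠ j := fun h => hij (Fin.ext h.symm)
    cases z <;> simp [score, record, Memory.write_apply, hij, this]

/-- The users, as seen by the server. -/
noncomputable def users (w T : ℕ) {b n : ℕ} (P : Fin n → Ranking (b + 1)) :
    ℕ → ℕ → PMF (Option ℕ) :=
  fun k q => if h : k < n then (bordaAlgorithm w).userAnswer T n (P ⟨k, h⟩) q else PMF.pure (some 0)

/-- Both branches of the conditional take equally long, so the step count is deterministic. -/
lemma runs_pollUser (w T b n : ℕ) (hT : 7 ≤ T) (P : Fin n → Ranking (b + 1)) (k : ℕ) (hk : k < n)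
    (s : State) (hs : Polled b n k s) :
    Runs (users w T P) (pollUser w) s 8 ((poll w P k).map (record w s)) := by
  intro t K
  obtain ⟨h0, h1, h3, h6, hi⟩ := hs
  rw [PMF.bind_map, poll, PMF.bind_bind, pollUser, run_seq, run_draw]
  have hb : Expr.val s.mem ((Expr.reg 0).sub (.lit 1)) = b := by
    simp [Expr.val, Expr.reg, h0]
  rw [hb, unif, PMF.bind_map]
  refine congrArg _ (funext fun i => ?_)
  rw [PMF.bind_map, Function.comp_apply, run_seq,
    run_call _ _ _ _ _ _ _ _ ((respond w b (position P k i)).map fun z => if z then 1 else 0)]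
  · rw [PMF.bind_map]
    refine congrArg _ (funext fun z => ?_)
    simp only [Function.comp_apply]
    rw [run_seq, run_cond]
    cases z
    · rw [if_neg (by simp [Expr.val, Expr.reg, Memory.write_apply]), run_set, run_set]
      simp [record, Expr.val, Expr.reg, Memory.write_apply]
    · rw [if_pos (by simp [Expr.val, Expr.reg, Memory.write_apply]), run_set, run_set]
      simp [record, Expr.val, Expr.reg, Memory.write_apply]
  · have e3 : Expr.val (s.mem.write 0 (Expr.val s.mem (.lit 4)) i) (.reg 3) = k := by
      simp [Expr.val, Expr.reg, Memory.write_apply, h3]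
    have e4 : Expr.val (s.mem.write 0 (Expr.val s.mem (.lit 4)) i) (.reg 4) = i := by
      simp [Expr.val, Expr.reg, Memory.write_apply]
    simp only [e3, e4]
    rw [users, dif_pos hk, userAnswer_bordaAlgorithm w T b n hT, position, dif_pos hk]

/-- Whether item `j` has to precede item `i`. -/
def Precedes (M : Memory) (j i : ℕ) : Prop :=
  M 2 j + M 3 i < M 2 i + M 3 j ∨ (M 2 j + M 3 i = M 2 i + M 3 j ∧ j < i)

/-- The number of items among the first `j` ones that have to precede item `i`. -/
noncomputable def countPrecedes (M : Memory) (j i : ℕ) : ℕ :=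
  open Classical in ((Finset.range j).filter fun l => Precedes M l i).card

/-- The state `s'` of the server when it computes the position of item `i`: the scores are those
of `s`, the positions of the smaller items are known, and those of larger items are zero. -/
def Placed (b : ℕ) (s : State) (i : ℕ) (s' : State) : Prop :=
  s'.mem 0 0 = b + 1 ∧ s'.mem 0 6 = i ∧ s'.mem 2 = s.mem 2 ∧ s'.mem 3 = s.mem 3 ∧
    (∀ l < i, s'.mem 1 l = countPrecedes s.mem (b + 1) l) ∧ (∀ l, i < l → s'.mem 1 l = 0)

/-- Item `i` was compared with the first `j` items. -/
def Compared (b : ℕ) (s : State) (i j : ℕ) (s' : State) : Prop :=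
  Placed b s i s' ∧ s'.mem 0 7 = j ∧ s'.mem 1 i = countPrecedes s.mem j i

lemma leads_compareItems (b : ℕ) (s : State) (i j : ℕ) (s' : State) (h : Compared b s i j s') :
    ∃ s'', Leads compareItems s' 3 s'' ∧ Compared b s i (j + 1) s'' := by
  classical
  refine ⟨_, (leads_set _ _ _ _).seq (leads_set _ _ _ _), ?_⟩
  obtain ⟨⟨h0, h6, h2, h3, hl, hg⟩, h7, hi⟩ := h
  refine ⟨⟨?_, ?_, ?_, ?_, ?_, ?_⟩, ?_, ?_⟩
  · simp [Expr.val, Memory.write_apply, h0]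
  · simp [Expr.val, Memory.write_apply, h6]
  · funext l
    simp [Memory.write_apply, h2]
  · funext l
    simp [Memory.write_apply, h3]
  · intro l hli
    simp [Expr.val, Expr.reg, Memory.write_apply, h6, hli.ne, hl l hli]
  · intro l hli
    simp [Expr.val, Expr.reg, Memory.write_apply, h6, hli.ne', hg l hli]
  · simp [Expr.val, Expr.reg, Memory.write_apply, h7]
  · rw [countPrecedes, Finset.range_add_one, Finset.filter_insert]
    simp only [Expr.val, Expr.reg, Memory.write_apply, h6, h7, h2, h3, hi, countPrecedes]
    by_cases hp : Precedes s.mem j i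
    · rw [if_pos hp, Finset.card_insert_of_notMem (by simp)]
      unfold Precedes at hp
      simp
      omega
    · rw [if_neg hp]
      unfold Precedes at hp
      simp
      omega

lemma leads_placeItem (b : ℕ) (s : State) (i : ℕ) (s' : State)
    (h : Placed b s i s' ∧ s'.mem 1 i = 0) :
    ∃ s'', Leads placeItem s' (1 + (((b + 1) * (3 + 1) + 1) + 1 + 1) + 1) s'' ∧
      Placed b s (i + 1) s'' ∧ s''.mem 1 (i + 1) = 0 := by
  obtain ⟨⟨h0, h6, h2, h3, hl, hg⟩, hi⟩ := h
  obtain ⟨s₁, hs₁, ⟨g0, g6, g2, g3, gl, gg⟩, g7, gi⟩ :=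
    leads_loop (x := .sub (.reg 0) (.reg 7)) (Compared b s i)
      (n := b + 1) (fun j hj s₁ hs₁ => ⟨by
        simp [Expr.val, Expr.reg, hs₁.1.1, hs₁.2.1]
        omega, leads_compareItems b s i j s₁ hs₁⟩)
      (fun s₁ hs₁ => by simp [Expr.val, Expr.reg, hs₁.1.1, hs₁.2.1]) (b + 1) 0
      ⟨s'.mem.write 0 7 0, s'.log⟩ (zero_add _) (by
        refine ⟨⟨?_, ?_, ?_, ?_, ?_, ?_⟩, ?_, ?_⟩ <;>
          simp +contextual [Memory.write_apply, h0, h6, ← h2, ← h3, hl, hg, hi, countPrecedes,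
            funext_iff])
  refine ⟨_, (leads_set _ _ _ _).seq (hs₁.seq (leads_set _ _ _ _)), ⟨?_, ?_, ?_, ?_, ?_, ?_⟩, ?_⟩
  · simp [Expr.val, Memory.write_apply, g0]
  · simp [Expr.val, Expr.reg, Memory.write_apply, g6]
  · funext l
    simp [Memory.write_apply, g2]
  · funext l
    simp [Memory.write_apply, g3]
  · intro l hli
    rcases (Nat.lt_succ_iff.1 hli).lt_or_eq with h | rfl
    · simp [Memory.write_apply, gl l h]
    · simp [Memory.write_apply, gi]
  · intro l hli
    simp [Memory.write_apply, gg l (by omega)]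
  · simp [Memory.write_apply, gg (i + 1) (by omega)]

lemma leads_sortItems (b n : ℕ) (s : State) (hs : Polled b n n s) :
    ∃ s', Leads sortItems s
        ((b + 1) * (1 + (((b + 1) * (3 + 1) + 1) + 1 + 1) + 1 + 1) + 1) s' ∧
      ∀ i : Fin (b + 1), s'.mem 1 i = countPrecedes s.mem (b + 1) i := by
  obtain ⟨h0, h1, h3, h6, hi⟩ := hs
  obtain ⟨s₁, hs₁, ⟨g0, g6, g2, g3, gl, gg⟩, -⟩ :=
    leads_loop (x := .sub (.reg 0) (.reg 6)) (n := b + 1)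
      (fun i s' => Placed b s i s' ∧ s'.mem 1 i = 0)
      (fun j hj s₁ hs₁ => ⟨by
        simp [Expr.val, Expr.reg, hs₁.1.1, hs₁.1.2.1]
        omega, leads_placeItem b s j s₁ hs₁⟩)
      (fun s₁ hs₁ => by simp [Expr.val, Expr.reg, hs₁.1.1, hs₁.1.2.1]) (b + 1) 0 s (zero_add _)
      ⟨⟨h0, h6, rfl, rfl, by simp, by simp [hi]⟩, hi 0⟩
  exact ⟨s₁, hs₁, fun i => gl i i.2⟩

/-- `Precedes` is the lexicographic order on pairs of score and index; the index makes the keys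
distinct. -/
lemma exists_ranking_countPrecedes {b : ℕ} (s : State) :
    ∃ σ : Ranking (b + 1), (∀ i : Fin (b + 1), countPrecedes s.mem (b + 1) i = (σ i : ℕ)) ∧
      ∀ i j, σ i < σ j → score s i ≤ score s j := by
  classical
  let key : Fin (b + 1) → ℤ ×ₗ Fin (b + 1) := fun i => toLex (score s i, i)
  obtain ⟨σ, hσ, hlt⟩ := exists_ranking_of_key key fun i j h => congrArg (fun p => (ofLex p).2) h
  refine ⟨σ, fun i => ?_, fun i j hij => ?_⟩
  · rw [hσ, countPrecedes, Finset.card_filter, Finset.card_filter, Finset.sum_range]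
    refine Finset.sum_congr rfl fun j _ => if_congr ?_ rfl rfl
    simp only [key, Prod.Lex.toLex_lt_toLex, Precedes, score, Fin.lt_def]
    omega
  · have := hlt i j hij
    simp only [key, Prod.Lex.toLex_lt_toLex] at this
    rcases this with h | h
    · exact h.le
    · exact h.1.le

lemma polled_start (b n : ℕ) : Polled b n 0 (start (b + 1) n 0) := by
  simp [Polled, start]

/-- The number of steps of the server. -/
def serverSteps (b n : ℕ) : ℕ :=
  n * (8 + 1) + 1 + ((b + 1) * (1 + (((b + 1) * (3 + 1) + 1) + 1 + 1) + 1 + 1) + 1) + 1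

/-- The execution of the algorithm is a fixed function of the recorded polls. -/
lemma exists_exec_eq (w b n : ℕ) : ∃ G : State → List Event × Ranking (b + 1),
    (∀ s i j, Polled b n n s → (G s).2 i < (G s).2 j → score s i ≤ score s j) ∧
    ∀ (P : Fin n → Ranking (b + 1)) (T : ℕ), 7 ≤ T → serverSteps b n ≤ T →
      (bordaAlgorithm w).exec T P =
        (foldPMF (poll w P) (record w) n 0 (start (b + 1) n 0)).map fun s => some (G s) := by
  -- Sorting is deterministic, so its result is chosen per state, before `P` and `T` are fixed. One
  -- function `G` thus serves all inputs, which makes the sorting pure post-processing; states that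
  -- are not `Polled` get a dummy value.
  have hex : ∀ s, ∃ p : State × Ranking (b + 1), Polled b n n s →
      Leads sortItems s ((b + 1) * (1 + (((b + 1) * (3 + 1) + 1) + 1 + 1) + 1 + 1) + 1) p.1 ∧
        readRanking (b + 1) (p.1.mem 1) = some p.2 ∧
        ∀ i j, p.2 i < p.2 j → score s i ≤ score s j := by
    intro s
    by_cases hs : Polled b n n s
    · obtain ⟨s', hs', hi⟩ := leads_sortItems b n s hs
      obtain ⟨σ, hσ, hle⟩ := exists_ranking_countPrecedes (b := b) s
      exact ⟨(s', σ), fun _ => ⟨hs', readRanking_eq_some _ _ fun i => by rw [hi, hσ], hle⟩⟩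
    · exact ⟨(s, 1), fun h => absurd h hs⟩
  choose F hF using hex
  refine ⟨fun s => ((F s).1.log, (F s).2), fun s i j hs => (hF s hs).2.2 i j, ?_⟩
  intro P T h7 hT
  obtain ⟨t, ht⟩ : ∃ t, T = t + serverSteps b n := ⟨T - serverSteps b n, by omega⟩
  have hloop := runs_loop (ext := users w T P)
    (x := .sub (.reg 1) (.reg 3)) (Polled b n) (poll w P) (record w)
    (fun k hk s hs => ⟨by
      simp [Expr.val, Expr.reg, hs.2.1, hs.2.2.1]
      omega, runs_pollUser w T b n h7 P k hk s hs⟩)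
    (fun k s a hs => polled_record w b n k s a hs)
    (fun s hs => by simp [Expr.val, Expr.reg, hs.2.1, hs.2.2.1]) n 0 (start (b + 1) n 0)
    (zero_add _) (polled_start b n)
  rw [LocalAlgorithm.exec]
  change (run (users w T P) T _ _).map _ = _
  -- The users' budget is also `T`; only the server's budget is to be split.
  generalize users w T P = ext at hloop ⊢
  rw [ht, serverSteps, bordaAlgorithm, ← add_assoc, run_seq, ← add_assoc, add_right_comm, hloop,
    PMF.map_bind, ← PMF.bind_pure_comp]
  refine pmf_bind_congr _ _ _ fun s hs => ?_
  have hs' := foldPMF_support _ _ (Polled b n) (fun k s a => polled_record w b n k s a) n 0 _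
    (polled_start b n) s hs
  rw [zero_add] at hs'
  obtain ⟨h1, h2, -⟩ := hF s hs'
  rw [h1, run_nil, PMF.pure_map, Function.comp_apply, Option.bind_some, h2, Option.map_some]

/-! ### Randomized response -/

lemma toReal_uniformOfFintype_fin (N : ℕ) (s : Fin (N + 1)) :
    ((PMF.uniformOfFintype (Fin (N + 1))) s).toReal = 1 / (N + 1 : ℝ) := by
  rw [PMF.uniformOfFintype_apply, Fintype.card_fin, ENNReal.toReal_inv, ENNReal.toReal_natCast,
    one_div]
  push_cast
  rfl

lemma toReal_map_decide_lt (N c : ℕ) (hc : c ≤ N + 1) :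
    (((unif N).map fun s => decide (s < c)) true).toReal = c / (N + 1 : ℝ) := by
  rw [unif, PMF.map_comp, ← PMF.bind_pure_comp, toReal_bind_apply]
  have h : ∀ s : Fin (N + 1), ((PMF.uniformOfFintype (Fin (N + 1))) s).toReal *
      ((PMF.pure ∘ ((fun s => decide (s < c)) ∘ Fin.val)) s true).toReal =
        (1 / (N + 1 : ℝ)) * if (s : ℕ) < c then 1 else 0 := by
    intro s
    rw [toReal_uniformOfFintype_fin]
    congr 1
    by_cases hs : (s : ℕ) < c <;> simp [PMF.pure_apply, hs]
  rw [Finset.sum_congr rfl fun s _ => h s, ← Finset.mul_sum, Finset.sum_boole]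
  have : (Finset.univ.filter fun s : Fin (N + 1) => (s : ℕ) < c).card = c := by
    rw [Fin.card_filter_val_lt]
    omega
  rw [this]
  ring

lemma toReal_respond_true (w b v : ℕ) (hv : v ≤ b + 1) :
    (respond w b v true).toReal = (w + v / (b + 1 : ℝ)) / (2 * w + 1) := by
  rw [respond, unif, PMF.bind_map, toReal_bind_apply]
  have h : ∀ r : Fin (b + 1), ((PMF.uniformOfFintype (Fin (b + 1))) r).toReal *
      (((fun r => (unif (2 * w)).map fun s => decide (s < w + if r < v then 1 else 0)) ∘ Fin.val) r
        true).toReal =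
        (1 / (b + 1 : ℝ)) / (2 * w + 1) * (w + if (r : ℕ) < v then 1 else 0) := by
    intro r
    rw [Function.comp_apply, toReal_map_decide_lt _ _ (by split_ifs <;> omega),
      toReal_uniformOfFintype_fin]
    push_cast
    ring
  rw [Finset.sum_congr rfl fun s _ => h s, ← Finset.mul_sum, Finset.sum_add_distrib,
    Finset.sum_boole, Fin.card_filter_val_lt, min_eq_right hv, Finset.sum_const, Finset.card_univ,
    Fintype.card_fin, nsmul_eq_mul]
  push_cast
  field_simp

lemma toReal_respond_false (w b v : ℕ) (hv : v ≤ b + 1) :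
    (respond w b v false).toReal = (w + (1 - v / (b + 1 : ℝ))) / (2 * w + 1) := by
  have h := sum_toReal (respond w b v)
  rw [Fintype.sum_bool, toReal_respond_true w b v hv] at h
  rw [← sub_eq_of_eq_add' h.symm]
  field_simp
  ring

/-- Both answers have probability between `w / (2 * w + 1)` and `(w + 1) / (2 * w + 1)`, and `1 + 1
/ w ≤ 1 + ε ≤ exp ε`. -/
lemma respond_private {ε : ℝ} (hε : 0 < ε) {w b v v' : ℕ} (hw : 1 / ε ≤ w) (hv : v ≤ b + 1)
    (hv' : v' ≤ b + 1) (z : Bool) :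
    (respond w b v z).toReal ≤ Real.exp ε * (respond w b v' z).toReal := by
  have key : ∀ x x' : ℝ, x ≤ 1 → 0 ≤ x' →
      (w + x) / (2 * w + 1) ≤ Real.exp ε * ((w + x') / (2 * w + 1)) := by
    intro x x' hx hx'
    rw [← mul_div_assoc]
    gcongr
    have h1 := Real.add_one_le_exp ε
    have h2 : 1 ≤ w * ε := (div_le_iff₀ hε).1 hw
    have h3 : (ε + 1) * (w + x') ≤ Real.exp ε * (w + x') := by gcongr
    nlinarith
  have hb : (0 : ℝ) < b + 1 := by positivity
  have h1 : (v : ℝ) / (b + 1) ≤ 1 := (div_le_one hb).2 (mod_cast hv)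
  have h2 : (v' : ℝ) / (b + 1) ≤ 1 := (div_le_one hb).2 (mod_cast hv')
  have h3 : 0 ≤ (v : ℝ) / (b + 1) := by positivity
  have h4 : 0 ≤ (v' : ℝ) / (b + 1) := by positivity
  cases z
  · rw [toReal_respond_false w b v hv, toReal_respond_false w b v' hv']
    exact key _ _ (by linarith) (by linarith)
  · rw [toReal_respond_true w b v hv, toReal_respond_true w b v' hv']
    exact key _ _ h1 h4

/-! ### Privacy and accuracy of the polls -/

section Poll

variable (w : ℕ) {b n : ℕ} (P P' : Fin n → Ranking (b + 1))

lemma position_le (k : ℕ) (i : Fin (b + 1)) : position P k i ≤ b + 1 := by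
  unfold position
  split_ifs with h
  · exact (P ⟨k, h⟩ i).2.le
  · exact Nat.zero_le _

lemma toReal_poll (k : ℕ) (i : Fin (b + 1)) (z : Bool) :
    (poll w P k (i, z)).toReal = 1 / (b + 1) * (respond w b (position P k i) z).toReal := by
  have h : ∀ j z', ((PMF.pure ∘ Prod.mk j) z' (i, z) : ENNReal).toReal =
      if j = i ∧ z' = z then 1 else 0 := by
    intro j z'
    simp only [Function.comp_apply, PMF.pure_apply, Prod.mk.injEq, eq_comm]
    split_ifs <;> simp
  rw [poll, toReal_bind_apply]
  simp_rw [← PMF.bind_pure_comp, toReal_bind_apply, h, toReal_uniformOfFintype_fin]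
  rw [Finset.sum_eq_single i]
  · cases z <;> simp
  · intro j _ hj
    simp [hj]
  · simp

lemma poll_private {ε : ℝ} (hε : 0 < ε) (hw : 1 / ε ≤ w) (k : ℕ) (a : Fin (b + 1) × Bool) :
    poll w P k a ≤ ENNReal.ofReal (Real.exp ε) * poll w P' k a := by
  obtain ⟨i, z⟩ := a
  rw [← ENNReal.toReal_le_toReal (PMF.apply_ne_top _ _)
    (ENNReal.mul_ne_top ENNReal.ofReal_ne_top (PMF.apply_ne_top _ _)), ENNReal.toReal_mul,
    ENNReal.toReal_ofReal (Real.exp_pos ε).le, toReal_poll, toReal_poll, mul_left_comm]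
  gcongr
  exact respond_private hε hw (position_le P k i) (position_le P' k i) z

/-- Each user is polled once, so the only likelihood ratio other than `1` is that of the differing
user. -/
lemma foldPMF_poll_private {ε : ℝ} (hε : 0 < ε) (hw : 1 / ε ≤ w) (h : Neighbouring P P')
    (s x : State) : foldPMF (poll w P) (record w) n 0 s x ≤
      ENNReal.ofReal (Real.exp ε) * foldPMF (poll w P') (record w) n 0 s x := by
  obtain ⟨k₀, hk₀⟩ := h
  have h1 := foldPMF_le (poll w P) (poll w P') (record w)
    (fun k => if (k₀ : ℕ) = k then ENNReal.ofReal (Real.exp ε) else 1) (fun k a => by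
      split_ifs with hk
      · exact poll_private w P P' hε hw k a
      · rw [one_mul]
        have : position P k = position P' k := by
          funext i
          unfold position
          split_ifs with h
          · rw [hk₀ ⟨k, h⟩ fun h' => hk (Fin.ext_iff.1 h').symm]
          · rfl
        rw [poll, poll, this]) n 0 s x
  rwa [zero_add, Finset.prod_ite_eq, if_pos (Finset.mem_Ico.2 ⟨Nat.zero_le _, k₀.2⟩)] at h1

/-- The change of the score of item `i` that is caused by a poll. -/
def gain (i : Fin (b + 1)) (a : Fin (b + 1) × Bool) : ℝ :=
  if a.1 = i then (if a.2 then (w + 1 : ℝ) else -w) else 0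

lemma sum_poll (k : ℕ) (i : Fin (b + 1)) (g : Bool → ℝ) :
    ∑ a, (poll w P k a).toReal * (if a.1 = i then g a.2 else 0) =
      1 / (b + 1) * ∑ z, (respond w b (position P k i) z).toReal * g z := by
  rw [Fintype.sum_prod_type, Finset.sum_eq_single i]
  · rw [Finset.mul_sum]
    refine Finset.sum_congr rfl fun z _ => ?_
    rw [if_pos rfl, toReal_poll, mul_assoc]
  · intro j _ hj
    simp [hj]
  · simp

/-- One factor `1 / (b + 1)` is the chance that `i` is asked about; the other is the scaling of
positions to probabilities. -/
lemma mean_gain (k : ℕ) (i : Fin (b + 1)) :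
    ∑ a, (poll w P k a).toReal * gain w i a = position P k i / (b + 1 : ℝ) ^ 2 := by
  unfold gain
  rw [sum_poll w P k i fun z => if z then (w + 1 : ℝ) else -w, Fintype.sum_bool,
    toReal_respond_true w b _ (position_le P k i), toReal_respond_false w b _ (position_le P k i)]
  simp only [if_true, Bool.false_eq_true, if_false]
  field_simp
  ring

lemma second_moment_gain (k : ℕ) (i : Fin (b + 1)) :
    ∑ a, (poll w P k a).toReal * gain w i a ^ 2 ≤ 1 / (b + 1) * (w + 1 : ℝ) ^ 2 := by
  have h : ∀ a : Fin (b + 1) × Bool, gain w i a ^ 2 =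
      if a.1 = i then (if a.2 then (w + 1 : ℝ) else -w) ^ 2 else 0 := by
    intro a
    unfold gain
    by_cases ha : a.1 = i <;> simp [ha]
  simp_rw [h]
  rw [sum_poll w P k i fun z => (if z then (w + 1 : ℝ) else -w) ^ 2]
  gcongr
  calc ∑ z, (respond w b (position P k i) z).toReal * (if z then (w + 1 : ℝ) else -w) ^ 2
      ≤ ∑ z, (respond w b (position P k i) z).toReal * (w + 1 : ℝ) ^ 2 := by
        refine Finset.sum_le_sum fun z _ => mul_le_mul_of_nonneg_left ?_ ENNReal.toReal_nonneg
        have : (0 : ℝ) ≤ w := Nat.cast_nonneg w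
        cases z
        · simp only [Bool.false_eq_true, if_false]
          nlinarith
        · simp
    _ = (w + 1 : ℝ) ^ 2 := by rw [← Finset.sum_mul, sum_toReal, one_mul]

lemma sum_position (hn : 1 ≤ n) (i : Fin (b + 1)) :
    ∑ k ∈ Finset.Ico 0 n, ((position P k i : ℕ) : ℝ) = n * borda P i := by
  have hn0 : (n : ℝ) ≠ 0 := by
    have : n ≠ 0 := by omega
    exact_mod_cast this
  rw [← Finset.range_eq_Ico, Finset.sum_range, borda, mul_div_cancel₀ _ hn0]
  refine Finset.sum_congr rfl fun k _ => ?_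
  rw [position, dif_pos k.2]

/-- The estimate of the average position of item `i`. -/
noncomputable def estimate (n : ℕ) {b : ℕ} (s : State) (i : Fin (b + 1)) : ℝ :=
  (b + 1 : ℝ) ^ 2 / n * score s i

/-- The score has mean `x` and is a sum of `n` independent gains with second moment at most `(w +
1)² / (b + 1)`. -/
lemma expected_error_le (hn : 1 ≤ n) (i : Fin (b + 1)) :
    foldExp (poll w P) (record w) (fun s => |estimate n s i - borda P i|) n 0
      (start (b + 1) n 0) ≤ (b + 1 : ℝ) ^ 2 / n * (√(n / (b + 1)) * (w + 1)) := by
  have hn0 : (0 : ℝ) < n := by exact_mod_cast hn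
  set x : ℝ := n * borda P i / (b + 1 : ℝ) ^ 2 with hx
  have h1 : ∀ s : State, |estimate n s i - borda P i| =
      (b + 1 : ℝ) ^ 2 / n * |(score s i : ℝ) - x| := by
    intro s
    have hpos : (0 : ℝ) < (b + 1 : ℝ) ^ 2 / n := by positivity
    have : estimate n s i - borda P i = (b + 1 : ℝ) ^ 2 / n * ((score s i : ℝ) - x) := by
      rw [hx, estimate]
      field_simp
    rw [this, abs_mul, abs_of_pos hpos]
  simp_rw [h1]
  rw [foldExp_mul]
  gcongr
  refine foldExp_abs_le _ _ _ _ _ _ _ (by positivity) ?_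
  have h2 := foldExp_sq_le (poll w P) (record w) (fun s => (score s i : ℝ)) (gain w i)
    (fun s a => by
      rw [score_record, gain]
      split_ifs <;> push_cast <;> ring)
    (fun k => position P k i / (b + 1 : ℝ) ^ 2) (1 / (b + 1) * (w + 1 : ℝ) ^ 2) n
    (fun k _ => mean_gain w P k i) (fun k _ => second_moment_gain w P k i) x n 0
    (start (b + 1) n 0) (zero_add n)
  refine h2.trans (le_of_eq ?_)
  rw [← Finset.sum_div, sum_position P hn, ← hx, mul_pow, Real.sq_sqrt (by positivity)]
  simp [score, start]
  ring

end Poll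

/-! ### The main theorem -/

section Main

variable {w b n T : ℕ}

lemma bordaAlgorithm_haltsWithin (h7 : 7 ≤ T) (hT : serverSteps b n ≤ T) :
    (bordaAlgorithm w).HaltsWithin T (b + 1) n := by
  intro P
  obtain ⟨G, -, hG⟩ := exists_exec_eq w b n
  rw [hG P T h7 hT, PMF.map_apply]
  simp

lemma bordaAlgorithm_isLocalDP (h7 : 7 ≤ T) (hT : serverSteps b n ≤ T) {ε : ℝ}
    (hε : 0 < ε) (hw : 1 / ε ≤ w) :
    (bordaAlgorithm w).IsLocalDP T (b + 1) n ε 0 := by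
  intro P P' h S
  obtain ⟨G, -, hG⟩ := exists_exec_eq w b n
  rw [LocalAlgorithm.transcript, LocalAlgorithm.transcript, hG P T h7 hT, hG P' T h7 hT,
    PMF.map_comp, PMF.map_comp, PMF.toOuterMeasure_map_apply, PMF.toOuterMeasure_map_apply,
    ENNReal.ofReal_zero, add_zero, PMF.toOuterMeasure_apply, PMF.toOuterMeasure_apply,
    ← ENNReal.tsum_mul_left]
  refine ENNReal.tsum_le_tsum fun s => ?_
  by_cases hs : s ∈ (Option.map Prod.fst ∘ fun s => some (G s)) ⁻¹' S
  · rw [Set.indicator_of_mem hs, Set.indicator_of_mem hs]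
    exact foldPMF_poll_private w P P' hε hw h _ s
  · rw [Set.indicator_of_notMem hs, Set.indicator_of_notMem hs, mul_zero]

lemma bordaAlgorithm_expectedScore_le (h7 : 7 ≤ T) (hT : serverSteps b n ≤ T)
    (hn : 1 ≤ n) (P : Fin n → Ranking (b + 1)) :
    (bordaAlgorithm w).expectedScore T P ≤
      5 * opt P + 2 * ((b + 1) * ((b + 1 : ℝ) ^ 2 / n * (√(n / (b + 1)) * (w + 1)))) := by
  obtain ⟨G, hle, hG⟩ := exists_exec_eq w b n
  have h1 : (bordaAlgorithm w).expectedScore T P = foldExp (poll w P) (record w)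
      (fun s => kemeny (G s).2 P) n 0 (start (b + 1) n 0) := by
    -- The outcome `none` is given cost `0`, matching a score summed over actual rankings only.
    have := sum_map_foldPMF (poll w P) (record w) (fun s => some (G s).2)
      (fun o => o.elim 0 fun σ => kemeny σ P) n 0 (start (b + 1) n 0)
    rw [Fintype.sum_option] at this
    simp only [Option.elim_none, Option.elim_some, mul_zero, zero_add] at this
    rw [← this, LocalAlgorithm.expectedScore, LocalAlgorithm.output, hG P T h7 hT, PMF.map_comp]
    rfl
  rw [h1]
  have h2 := foldExp_mono (poll w P) (record w) (fun s => kemeny (G s).2 P)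
    (fun s => 5 * opt P + 2 * ∑ i, |estimate n s i - borda P i|) (Polled b n)
    (fun k s a => polled_record w b n k s a) n (fun s hs => by
      refine kemeny_le_of_sorted hn P _ (estimate n s) fun i j hij => ?_
      unfold estimate
      have : (score s i : ℝ) ≤ score s j := mod_cast hle s i j hs hij
      gcongr) n 0 (start (b + 1) n 0) (zero_add n) (polled_start b n)
  refine h2.trans ?_
  rw [foldExp_add, foldExp_const, foldExp_mul, foldExp_sum]
  gcongr
  refine (Finset.sum_le_sum fun i _ => expected_error_le w P hn i).trans (le_of_eq ?_)
  rw [Finset.sum_const, Finset.card_univ, Fintype.card_fin, nsmul_eq_mul]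
  push_cast
  rfl

end Main

/-- With `B = b + 1` the count is `9 * n + 4 * B² + 6 * B + 3`, and `9 + 4 + 6 + 3 = 22`. -/
lemma serverSteps_le (b n : ℕ) (hn : 1 ≤ n) : serverSteps b n ≤ 22 * (n * (b + 1)) ^ 2 := by
  have h1 : n ≤ (n * (b + 1)) ^ 2 := by nlinarith [Nat.zero_le b, Nat.zero_le (n * b)]
  have h2 : (b + 1) ^ 2 ≤ (n * (b + 1)) ^ 2 :=
    Nat.pow_le_pow_left (Nat.le_mul_of_pos_left _ hn) 2
  unfold serverSteps
  nlinarith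

lemma kendallTau_eq_zero (σ π : Ranking 1) : kendallTau σ π = 0 := by
  rw [kendallTau, Finset.card_eq_zero, Finset.filter_eq_empty_iff]
  rintro p - ⟨h, -⟩
  rw [Subsingleton.elim p.1 p.2] at h
  exact lt_irrefl _ h

/-- The error of the algorithm in terms of the parameters of the main theorem. -/
lemma error_le {ε M N l : ℝ} (hε : 0 < ε) (hM : 0 < M) (hN : 0 < N) (hl : 1 / 2 ≤ l) {w : ℝ}
    (hw0 : 0 ≤ w) (hw : w ≤ 1 / ε + 1) :
    2 * (M * (M ^ 2 / N * (√(N / M) * (w + 1)))) ≤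
      12 * (M ^ (5 / 2 : ℝ) * l / (min ε (max 1 l) * √N)) := by
  -- The logarithm in the numerator pays for replacing `max 1 l` by `1`; this needs `l` bounded away
  -- from zero.
  have hmin : min ε (max 1 l) ≤ 2 * l * min ε 1 := by
    have hmax : max 1 l ≤ 2 * l := max_le (by linarith) (by linarith)
    rcases le_total ε 1 with h | h
    · rw [min_eq_left h]
      exact (min_le_left _ _).trans (by nlinarith)
    · rw [min_eq_right h]
      exact (min_le_right _ _).trans (by linarith)
  have hminpos : 0 < min ε (max 1 l) := lt_min hε (lt_of_lt_of_le one_pos (le_max_left _ _))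
  -- From `w + 1 ≤ 1 / ε + 2`, where the rounding of `1 / ε` costs at most one.
  have hw1 : (w + 1) * min ε 1 ≤ 3 := by
    have h1 : 1 / ε * min ε 1 ≤ 1 := by
      rw [div_mul_eq_mul_div, one_mul, div_le_one hε]
      exact min_le_left _ _
    have h2 : min ε 1 ≤ 1 := min_le_right _ _
    have h3 : 0 < min ε 1 := lt_min hε one_pos
    nlinarith
  have hw2 : w + 1 ≤ 6 * l / min ε (max 1 l) := by
    rw [le_div_iff₀ hminpos]
    calc (w + 1) * min ε (max 1 l) ≤ (w + 1) * (2 * l * min ε 1) := by gcongr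
      _ = 2 * l * ((w + 1) * min ε 1) := by ring
      _ ≤ 2 * l * 3 := by gcongr
      _ = 6 * l := by ring
  have hM5 : M ^ (5 / 2 : ℝ) = M ^ 2 * √M := by
    rw [Real.sqrt_eq_rpow, ← Real.rpow_natCast, ← Real.rpow_add hM]
    norm_num
  have hs : M * (M ^ 2 / N * √(N / M)) = M ^ 2 * √M / √N := by
    rw [Real.sqrt_div hN.le]
    have h1 := Real.sq_sqrt hM.le
    have h2 := Real.sq_sqrt hN.le
    have h3 := Real.sqrt_pos.2 hM
    have h4 := Real.sqrt_pos.2 hN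
    field_simp
    rw [h1, h2]
    ring
  calc 2 * (M * (M ^ 2 / N * (√(N / M) * (w + 1))))
      = 2 * (M * (M ^ 2 / N * √(N / M))) * (w + 1) := by ring
    _ = 2 * (M ^ 2 * √M / √N) * (w + 1) := by rw [hs]
    _ ≤ 2 * (M ^ 2 * √M / √N) * (6 * l / min ε (max 1 l)) := by gcongr
    _ = _ := by
      rw [hM5]
      have h4 := Real.sqrt_pos.2 hN
      field_simp
      ring

end RankAgg

open RankAgg in
theorem mainTheorem3 (ξ : ℝ) (hξ : 0 < ξ) :
    ∃ (C : ℝ) (c d : ℕ), 0 < C ∧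
      ∀ ε : ℝ, 0 < ε →
        ∃ A : RankAgg.LocalAlgorithm,
          ∀ m n : ℕ, 1 ≤ m → 1 ≤ n →
            A.HaltsWithin (c * (n * m) ^ d) m n ∧
            A.IsLocalDP (c * (n * m) ^ d) m n ε 0 ∧
            A.IsApprox (c * (n * m) ^ d) m n (5 + ξ)
              (C * ((m : ℝ) ^ (5 / 2 : ℝ) * Real.log m /
                (min ε (max 1 (Real.log m)) * Real.sqrt n))) := by
  refine ⟨12, 22, 2, by norm_num, fun ε hε => ⟨bordaAlgorithm ⌈1 / ε⌉₊, fun m n hm hn => ?_⟩⟩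
  obtain ⟨b, rfl⟩ : ∃ b, m = b + 1 := ⟨m - 1, by omega⟩
  have hT := serverSteps_le b n hn
  have h7 : 7 ≤ 22 * (n * (b + 1)) ^ 2 := by
    have : 1 ≤ (n * (b + 1)) ^ 2 := Nat.one_le_pow _ _ (Nat.mul_pos hn (Nat.succ_pos b))
    omega
  refine ⟨bordaAlgorithm_haltsWithin h7 hT, bordaAlgorithm_isLocalDP h7 hT hε (Nat.le_ceil _),
    fun P => ?_⟩
  -- For one item the logarithm vanishes and no additive error is allowed, but then every cost is
  -- zero.
  rcases Nat.eq_zero_or_pos b with rfl | hb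
  · have h0 : ∀ σ, kemeny σ P = 0 := fun σ => by simp [kemeny, kendallTau_eq_zero]
    have := opt_nonneg P
    simp only [LocalAlgorithm.expectedScore, h0, mul_zero, Finset.sum_const_zero, zero_add,
      Nat.cast_one, Real.log_one, zero_div, add_zero]
    positivity
  · refine (bordaAlgorithm_expectedScore_le h7 hT hn P).trans (add_le_add ?_ ?_)
    · nlinarith [opt_nonneg P]
    · have hl : 1 / 2 ≤ Real.log ((b + 1 : ℕ) : ℝ) := by
        have h1 : (2 : ℝ) ≤ ((b + 1 : ℕ) : ℝ) := by exact_mod_cast Nat.succ_le_succ hb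
        have h2 := Real.log_le_log two_pos h1
        linarith [Real.log_two_gt_d9]
      have := error_le (M := ((b + 1 : ℕ) : ℝ)) (N := n) hε (by positivity) (by exact_mod_cast hn)
        hl (Nat.cast_nonneg _) (Nat.ceil_lt_add_one (by positivity)).le
      push_cast at this ⊢
      exact this
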